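/- Let $$E_5=\bigl\{[0;a_1,a_2,a_3,\dots] \;:\; a_n\in\{1,2,3,4,5\}\text{ for all } n\ge 1\bigr\}\subset[0,1]$$ be the set of values of all infinite continued fractions $$[0;a_1,a_2,a_3,\dots]=\cfrac{1}{a_1+\cfrac{1}{a_2+\cfrac{1}{a_3+\cdots}}}$$ with digits in $\{1,\dots,5\}$, where the value is the limit of the convergents $[0;a_1,\dots,a_n]$ as $n\to\infty$. Then the Hausdorff dimension of $E_5$ satisfies $$\dim_H(E_5)=0.836829443681\pm 10^{-12},$$ that is, $0.836829443681-10^{-12}\le \dim_H(E_5)\le 0.836829443681+10^{-12}$. In particular $\dim_H(E_5)>\tfrac56$. -/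

import Mathlib

open Filter Topology MeasureTheory
open scoped ENNReal

/-- The infinite regular continued fraction `[0; a 0, a 1, a 2, …]`: integer part `0`, all partial
numerators `1`, partial denominators `a 0, a 1, a 2, …`. -/
noncomputable def regularContFract (a : ℕ → ℕ) : GenContFract ℝ where
  h := 0
  s := Stream'.Seq.ofStream fun n => ⟨1, (a n : ℝ)⟩

/-- `contFractSet m` is the set of the values `[0; a 0, a 1, …]`, that is, of the limits of the
convergents, of all infinite continued fractions with digits in `{1, …, m}`. -/
def contFractSet (m : ℕ) : Set ℝ :=
  {x | ∃ a : ℕ → ℕ, (∀ n, a n ∈ Set.Icc 1 m) ∧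
    Tendsto (regularContFract a).convs atTop (𝓝 x)}

/-! The branches `x ↦ 1 / (a + x)`, `1 ≤ a ≤ m`, generate the set as the limit set of a system of
contractions with separated images and bounded distortion. Let `L_t` be its transfer operator at
the exponent `t`, whose iterates sum the powers `|φ_w'| ^ t` over the words `w` of a given length,
and let `f` be a positive function. If `L_t f ≤ f`, these sums are bounded, and the covers by the
images of the words show that the dimension is at most `t`. If `f ≤ L_t f`, then for `t' < t` the
sums at `t'` grow exponentially, so that for long words they beat the distortion constants, and
Moran's construction for the system of words of that length bounds the dimension below by `t'`.

For `m = 5` a single polynomial, an approximate eigenfunction, satisfies both inequalities at the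
two endpoints of the interval. Its image under the transfer operator is enclosed by integer
polynomials with error bounds. In these, the irrational powers `(a + x) ^ (-2 t)` are controlled
through the residual of the linear differential equation that they satisfy. -/

open scoped NNReal

section HausdorffDimension

theorem dimH_le_of_finite_covers {X : Type*} [EMetricSpace X] {E : Set X} {t C : ℝ≥0}
    {δ : ℕ → ℝ≥0∞} (hδ : Tendsto δ atTop (𝓝 0)) {κ : ℕ → Type*} [∀ n, Fintype (κ n)]
    {U : ∀ n, κ n → Set X} (hcover : ∀ n, E ⊆ ⋃ i, U n i)
    (hdiam : ∀ n i, Metric.ediam (U n i) ≤ δ n)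
    (hsum : ∀ n, ∑ i, Metric.ediam (U n i) ^ (t : ℝ) ≤ C) : dimH E ≤ t := by
  borelize X
  have hμ : μH[t] E ≤ C :=
    (Measure.hausdorffMeasure_le_liminf_sum (t : ℝ) E δ hδ U (Eventually.of_forall hdiam)
      (Eventually.of_forall hcover)).trans
      ((liminf_le_liminf (Eventually.of_forall hsum)).trans (liminf_const _).le)
  exact dimH_le_of_hausdorffMeasure_ne_top (ne_top_of_le_ne_top ENNReal.coe_ne_top hμ)

theorem mul_dimH_le_dimH_image {X Y : Type*} [EMetricSpace X] [EMetricSpace Y] {T : X → Y}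
    {s : Set X} {C t : ℝ≥0} (ht : 0 < t)
    (hT : ∀ x ∈ s, ∀ y ∈ s, edist x y ≤ C * edist (T x) (T y) ^ (t : ℝ)) :
    t * dimH s ≤ dimH (T '' s) := by
  rcases s.eq_empty_or_nonempty with rfl | ⟨x₀, -⟩
  · simp
  have : Nonempty X := ⟨x₀⟩
  have hinj : Set.InjOn T s := fun x hx y hy h => by
    have hxy := hT x hx y hy
    rwa [h, edist_self, ENNReal.zero_rpow_of_pos (by exact_mod_cast ht), mul_zero,
      nonpos_iff_eq_zero, edist_eq_zero] at hxy
  have hleft := hinj.leftInvOn_invFunOn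
  have hHolder : HolderOnWith C t (Function.invFunOn T s) (T '' s) := by
    rintro _ ⟨x, hx, rfl⟩ _ ⟨y, hy, rfl⟩
    rw [hleft hx, hleft hy]
    exact hT x hx y hy
  have hdim := hHolder.dimH_image_le ht
  rw [hleft.image_image] at hdim
  rw [mul_comm]
  exact ENNReal.mul_le_of_le_div hdim

end HausdorffDimension

section Moran

variable {ι : Type*}

theorem exists_digit_expansion [Fintype ι] {p : ι → ℝ} (hp : ∀ i, 0 < p i) (hsum : ∑ i, p i = 1) :
    ∃ (c : ι → ℝ) (a : ℝ → ι) (σ : ℝ → ℝ), ∀ y ∈ Set.Ico (0 : ℝ) 1,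
      σ y ∈ Set.Ico (0 : ℝ) 1 ∧ y = c (a y) + p (a y) * σ y := by
  classical
  have partition : ∀ s : Finset ι, ∃ c : ι → ℝ, ∀ y ∈ Set.Ico (0 : ℝ) (∑ i ∈ s, p i),
      ∃ i ∈ s, ∃ y' ∈ Set.Ico (0 : ℝ) 1, y = c i + p i * y' := by
    intro s
    induction s using Finset.induction_on with
    | empty => exact ⟨0, fun y hy => absurd (hy.1.trans_lt hy.2) (by simp)⟩
    | insert j s hj ih =>
      obtain ⟨c, hc⟩ := ih
      refine ⟨Function.update c j (∑ i ∈ s, p i), fun y hy => ?_⟩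
      rw [Finset.sum_insert hj] at hy
      rcases lt_or_ge y (∑ i ∈ s, p i) with hlt | hge
      · obtain ⟨i, hi, y', hy', hyi⟩ := hc y ⟨hy.1, hlt⟩
        refine ⟨i, Finset.mem_insert_of_mem hi, y', hy', ?_⟩
        rwa [Function.update_of_ne (ne_of_mem_of_not_mem hi hj)]
      · refine ⟨j, Finset.mem_insert_self _ _, (y - ∑ i ∈ s, p i) / p j, ⟨?_, ?_⟩, ?_⟩
        · exact div_nonneg (sub_nonneg.2 hge) (hp j).le
        · rw [div_lt_one (hp j)]
          linarith [hy.2]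
        · rw [Function.update_self, mul_div_cancel₀ _ (hp j).ne', add_sub_cancel]
  obtain ⟨c, hc⟩ := partition Finset.univ
  rw [hsum] at hc
  have : Nonempty ι := ⟨(hc 0 (by simp)).choose⟩
  choose! a _ σ hσ using hc
  exact ⟨c, a, σ, hσ⟩

variable {X : Type*} [MetricSpace X] {φ : ι → X → X} {r : ι → ℝ} {g : ℝ}

theorem abs_sub_le_rpow_dist_add_pow {a : ℝ → ι} {σ : ℝ → ℝ} {T : ℝ → X} {c p : ι → ℝ} {t κ : ℝ}
    (ht : 0 < t) (hg : 0 < g) (hr₀ : ∀ i, 0 ≤ r i) (hp₀ : ∀ i, 0 ≤ p i)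
    (hpr : ∀ i, p i ≤ r i ^ t) (hpκ : ∀ i, p i ≤ κ)
    (hr : ∀ i x y, r i * dist x y ≤ dist (φ i x) (φ i y))
    (hsep : ∀ i j, i ≠ j → ∀ x y, g ≤ dist (φ i x) (φ j y))
    (hT : ∀ y, T y = φ (a y) (T (σ y)))
    (hσ : ∀ y ∈ Set.Ico (0 : ℝ) 1, σ y ∈ Set.Ico (0 : ℝ) 1 ∧ y = c (a y) + p (a y) * σ y)
    (n : ℕ) {y z : ℝ} (hy : y ∈ Set.Ico (0 : ℝ) 1) (hz : z ∈ Set.Ico (0 : ℝ) 1) :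
    |y - z| ≤ (dist (T y) (T z) / g) ^ t + κ ^ n := by
  have hκ : 0 ≤ κ := (hp₀ (a 0)).trans (hpκ _)
  have hunit : |y - z| ≤ 1 := abs_le.2 ⟨by linarith [hy.1, hz.2], by linarith [hy.2, hz.1]⟩
  induction n generalizing y z with
  | zero =>
    rw [pow_zero]
    linarith [show 0 ≤ (dist (T y) (T z) / g) ^ t by positivity]
  | succ n ih =>
    obtain ⟨hσy, hy_eq⟩ := hσ y hy
    obtain ⟨hσz, hz_eq⟩ := hσ z hz
    by_cases h : a y = a z
    · have hunit' : |σ y - σ z| ≤ 1 :=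
        abs_le.2 ⟨by linarith [hσy.1, hσz.2], by linarith [hσy.2, hσz.1]⟩
      have hscale : y - z = p (a y) * (σ y - σ z) := by
        rw [← h] at hz_eq
        linear_combination hy_eq - hz_eq
      have hexpand : r (a y) * dist (T (σ y)) (T (σ z)) ≤ dist (T y) (T z) := by
        rw [hT y, hT z, ← h]
        exact hr _ _ _
      have := hr₀ (a y)
      calc |y - z| = p (a y) * |σ y - σ z| := by rw [hscale, abs_mul, abs_of_nonneg (hp₀ _)]
        _ ≤ p (a y) * ((dist (T (σ y)) (T (σ z)) / g) ^ t + κ ^ n) :=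
          mul_le_mul_of_nonneg_left (ih hσy hσz hunit') (hp₀ _)
        _ ≤ r (a y) ^ t * (dist (T (σ y)) (T (σ z)) / g) ^ t + κ * κ ^ n := by
          rw [mul_add]
          gcongr
          exacts [hpr _, hpκ _]
        _ = (r (a y) * dist (T (σ y)) (T (σ z)) / g) ^ t + κ ^ (n + 1) := by
          rw [← Real.mul_rpow (hr₀ _) (by positivity), pow_succ', mul_div_assoc]
        _ ≤ (dist (T y) (T z) / g) ^ t + κ ^ (n + 1) := by gcongr
    · have hgap : 1 ≤ (dist (T y) (T z) / g) ^ t := by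
        refine Real.one_le_rpow ((one_le_div hg).2 ?_) ht.le
        rw [hT y, hT z]
        exact hsep _ _ h _ _
      linarith [pow_nonneg hκ (n + 1)]

/-- The expansion of `y ∈ [0, 1)` in a number system with digit weights proportional to `r i ^ t`
is the code of a point whose distances control those of the parameters, so the limit set is the
image of `[0, 1)` under a map with `t`-Hölder inverse. -/
theorem le_dimH_range_of_one_le_sum_rpow [Fintype ι] {π : (ℕ → ι) → X}
    (hπ : ∀ a, π a = φ (a 0) (π fun n => a (n + 1))) {t : ℝ≥0} (ht : 0 < t) (hg : 0 < g)
    (hr₀ : ∀ i, 0 < r i) (hr₁ : ∀ i, r i < 1)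
    (hr : ∀ i x y, r i * dist x y ≤ dist (φ i x) (φ i y))
    (hsep : ∀ i j, i ≠ j → ∀ x y, g ≤ dist (φ i x) (φ j y))
    (hsum : 1 ≤ ∑ i, r i ^ (t : ℝ)) : (t : ℝ≥0∞) ≤ dimH (Set.range π) := by
  set Z := ∑ i, r i ^ (t : ℝ)
  set p : ι → ℝ := fun i => r i ^ (t : ℝ) / Z
  have hZ : 0 < Z := one_pos.trans_le hsum
  have hrt : ∀ i, 0 < r i ^ (t : ℝ) := fun i => Real.rpow_pos_of_pos (hr₀ i) _
  have hp₀ : ∀ i, 0 < p i := fun i => div_pos (hrt i) hZ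
  have hpr : ∀ i, p i ≤ r i ^ (t : ℝ) := fun i => div_le_self (hrt i).le hsum
  obtain ⟨c, a, σ, hσ⟩ := exists_digit_expansion hp₀ (by rw [← Finset.sum_div, div_self hZ.ne'])
  have : Nonempty ι := ⟨a 0⟩
  obtain ⟨i₀, hi₀⟩ := Finite.exists_max p
  have hκ : p i₀ < 1 := (hpr i₀).trans_lt (Real.rpow_lt_one (hr₀ _).le (hr₁ _) ht)
  set T : ℝ → X := fun y => π fun k => a (σ^[k] y)
  have hT : ∀ y, T y = φ (a y) (T (σ y)) := fun y => hπ _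
  have hHolder : ∀ y ∈ Set.Ico (0 : ℝ) 1, ∀ z ∈ Set.Ico (0 : ℝ) 1,
      |y - z| ≤ (dist (T y) (T z) / g) ^ (t : ℝ) := fun y hy z hz => by
    have hlim := (tendsto_pow_atTop_nhds_zero_of_lt_one (hp₀ i₀).le hκ).const_add
      ((dist (T y) (T z) / g) ^ (t : ℝ))
    rw [add_zero] at hlim
    exact ge_of_tendsto' hlim fun n => abs_sub_le_rpow_dist_add_pow (by exact_mod_cast ht) hg
      (fun i => (hr₀ i).le) (fun i => (hp₀ i).le) hpr hi₀ hr hsep hT hσ n hy hz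
  have hdim := mul_dimH_le_dimH_image (T := T) (C := (g⁻¹ ^ (t : ℝ)).toNNReal) ht
    fun y hy z hz => by
      rw [edist_dist, edist_dist, Real.dist_eq,
        ENNReal.ofReal_rpow_of_nonneg dist_nonneg t.coe_nonneg]
      change _ ≤ ENNReal.ofReal _ * _
      rw [← ENNReal.ofReal_mul (by positivity), ← Real.mul_rpow (by positivity) dist_nonneg,
        inv_mul_eq_div]
      exact ENNReal.ofReal_le_ofReal (hHolder y hy z hz)
  rw [Real.dimH_of_nonempty_interior ⟨1 / 2, by rw [interior_Ico]; norm_num⟩, Module.finrank_self,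
    Nat.cast_one, mul_one] at hdim
  exact hdim.trans (dimH_mono (Set.image_subset_iff.2 fun y _ => Set.mem_range_self _))

end Moran

theorem dist_le_diam_univ {X : Type*} [PseudoMetricSpace X] [BoundedSpace X] (x y : X) :
    dist x y ≤ Metric.diam (Set.univ : Set X) :=
  Metric.dist_le_diam_of_mem (Bornology.IsBounded.all _) trivial trivial

/-- An iterated function system with digit set `ι` on a metric space: uniform contractions with
uniformly separated images, each dilating distances near `x` by the factor `deriv i x` up to an
error exponential in the distance. -/
structure ConformalIFS (ι X : Type*) [MetricSpace X] where
  map : ι → X → X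
  deriv : ι → X → ℝ
  ratio : ℝ
  distortion : ℝ
  minDeriv : ℝ
  gap : ℝ
  ratio_nonneg : 0 ≤ ratio
  ratio_lt_one : ratio < 1
  distortion_nonneg : 0 ≤ distortion
  minDeriv_pos : 0 < minDeriv
  gap_pos : 0 < gap
  minDeriv_le : ∀ i x, minDeriv ≤ deriv i x
  deriv_le_ratio : ∀ i x, deriv i x ≤ ratio
  dist_map_le : ∀ i x y, dist (map i x) (map i y) ≤ ratio * dist x y
  deriv_mul_dist_le : ∀ i x y,
    deriv i x * dist x y ≤ Real.exp (distortion * dist x y) * dist (map i x) (map i y)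
  dist_map_le_deriv : ∀ i x y,
    dist (map i x) (map i y) ≤ Real.exp (distortion * dist x y) * (deriv i x * dist x y)
  gap_le_dist : ∀ i j, i ≠ j → ∀ x y, gap ≤ dist (map i x) (map j y)

namespace ConformalIFS

variable {ι X : Type*} [MetricSpace X] (F : ConformalIFS ι X)

/-- The composition `map (w 0) ∘ ⋯ ∘ map (w (n - 1))` along a word `w` of length `n`. -/
def wordMap : (n : ℕ) → (Fin n → ι) → X → X
  | 0, _, x => x
  | n + 1, w, x => F.map (w 0) (wordMap n (Fin.tail w) x)

/-- The local dilation factor of `wordMap`, by the chain rule. -/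
def wordDeriv : (n : ℕ) → (Fin n → ι) → X → ℝ
  | 0, _, _ => 1
  | n + 1, w, x => F.deriv (w 0) (F.wordMap n (Fin.tail w) x) * wordDeriv n (Fin.tail w) x

theorem deriv_pos (i : ι) (x : X) : 0 < F.deriv i x := F.minDeriv_pos.trans_le (F.minDeriv_le i x)

theorem continuous_map (i : ι) : Continuous (F.map i) :=
  (LipschitzWith.of_dist_le_mul (K := ⟨F.ratio, F.ratio_nonneg⟩) (F.dist_map_le i)).continuous

section Words

variable {n : ℕ}

theorem wordMap_succ_last (w : Fin (n + 1) → ι) (x : X) :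
    F.wordMap (n + 1) w x = F.wordMap n (Fin.init w) (F.map (w (Fin.last n)) x) := by
  induction n with
  | zero => rfl
  | succ n ih => exact congrArg (F.map (w 0)) (ih (Fin.tail w))

theorem wordDeriv_pos (w : Fin n → ι) (x : X) : 0 < F.wordDeriv n w x := by
  induction n with
  | zero => exact one_pos
  | succ n ih => exact mul_pos (F.deriv_pos _ _) (ih _)

theorem wordDeriv_le_ratio_pow (w : Fin n → ι) (x : X) : F.wordDeriv n w x ≤ F.ratio ^ n := by
  induction n with
  | zero => exact (pow_zero _).ge
  | succ n ih =>
    rw [pow_succ']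
    exact mul_le_mul (F.deriv_le_ratio _ _) (ih _) (F.wordDeriv_pos _ _).le F.ratio_nonneg

theorem dist_wordMap_le (w : Fin n → ι) (x y : X) :
    dist (F.wordMap n w x) (F.wordMap n w y) ≤ F.ratio ^ n * dist x y := by
  induction n with
  | zero => rw [pow_zero, one_mul]; rfl
  | succ n ih =>
    rw [pow_succ', mul_assoc]
    exact (F.dist_map_le _ _ _).trans (mul_le_mul_of_nonneg_left (ih _) F.ratio_nonneg)

theorem wordDeriv_mul_dist_le_exp_geom_sum (w : Fin n → ι) (x y : X) :
    F.wordDeriv n w x * dist x y ≤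
      Real.exp (F.distortion * ((∑ k ∈ Finset.range n, F.ratio ^ k) * dist x y)) *
        dist (F.wordMap n w x) (F.wordMap n w y) := by
  induction n with
  | zero => simp [wordDeriv, wordMap]
  | succ n ih =>
    set x' := F.wordMap n (Fin.tail w) x
    set y' := F.wordMap n (Fin.tail w) y
    have := F.distortion_nonneg
    have := F.deriv_pos (w 0) x'
    calc F.deriv (w 0) x' * F.wordDeriv n (Fin.tail w) x * dist x y
        = F.deriv (w 0) x' * (F.wordDeriv n (Fin.tail w) x * dist x y) := mul_assoc _ _ _
      _ ≤ F.deriv (w 0) x' * (Real.exp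
            (F.distortion * ((∑ k ∈ Finset.range n, F.ratio ^ k) * dist x y)) * dist x' y') :=
        mul_le_mul_of_nonneg_left (ih _) this.le
      _ = Real.exp (F.distortion * ((∑ k ∈ Finset.range n, F.ratio ^ k) * dist x y)) *
            (F.deriv (w 0) x' * dist x' y') := by ring
      _ ≤ Real.exp (F.distortion * ((∑ k ∈ Finset.range n, F.ratio ^ k) * dist x y)) *
            (Real.exp (F.distortion * (F.ratio ^ n * dist x y)) *
              dist (F.map (w 0) x') (F.map (w 0) y')) := by
        refine mul_le_mul_of_nonneg_left ?_ (Real.exp_pos _).le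
        refine (F.deriv_mul_dist_le _ _ _).trans ?_
        gcongr
        exact F.dist_wordMap_le _ _ _
      _ = Real.exp (F.distortion * ((∑ k ∈ Finset.range (n + 1), F.ratio ^ k) * dist x y)) *
            dist (F.map (w 0) x') (F.map (w 0) y') := by
        rw [← mul_assoc, ← Real.exp_add, Finset.sum_range_succ]
        ring_nf

theorem dist_wordMap_le_exp_geom_sum (w : Fin n → ι) (x y : X) :
    dist (F.wordMap n w x) (F.wordMap n w y) ≤
      Real.exp (F.distortion * ((∑ k ∈ Finset.range n, F.ratio ^ k) * dist x y)) *
        (F.wordDeriv n w x * dist x y) := by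
  induction n with
  | zero => simp [wordDeriv, wordMap]
  | succ n ih =>
    set x' := F.wordMap n (Fin.tail w) x
    set y' := F.wordMap n (Fin.tail w) y
    have := F.distortion_nonneg
    have := F.deriv_pos (w 0) x'
    calc dist (F.map (w 0) x') (F.map (w 0) y')
        ≤ Real.exp (F.distortion * dist x' y') * (F.deriv (w 0) x' * dist x' y') :=
          F.dist_map_le_deriv _ _ _
      _ ≤ Real.exp (F.distortion * (F.ratio ^ n * dist x y)) * (F.deriv (w 0) x' * (Real.exp
            (F.distortion * ((∑ k ∈ Finset.range n, F.ratio ^ k) * dist x y)) *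
              (F.wordDeriv n (Fin.tail w) x * dist x y))) := by
        gcongr
        exacts [F.dist_wordMap_le _ _ _, ih _]
      _ = Real.exp (F.distortion * (F.ratio ^ n * dist x y)) * Real.exp
            (F.distortion * ((∑ k ∈ Finset.range n, F.ratio ^ k) * dist x y)) *
              (F.deriv (w 0) x' * F.wordDeriv n (Fin.tail w) x * dist x y) := by ring
      _ = Real.exp (F.distortion * ((∑ k ∈ Finset.range (n + 1), F.ratio ^ k) * dist x y)) *
            (F.wordDeriv (n + 1) w x * dist x y) := by
        rw [← Real.exp_add, Finset.sum_range_succ]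
        change _ = _ * (F.deriv (w 0) x' * F.wordDeriv n (Fin.tail w) x * dist x y)
        ring_nf

/-- The exponential of the total distortion accumulated along an orbit: the distances of the images
of a pair of points decrease geometrically. -/
noncomputable def distortionConst : ℝ :=
  Real.exp (F.distortion * ((1 - F.ratio)⁻¹ * Metric.diam (Set.univ : Set X)))

theorem one_le_distortionConst : 1 ≤ F.distortionConst :=
  Real.one_le_exp (mul_nonneg F.distortion_nonneg
    (mul_nonneg (inv_nonneg.2 (sub_nonneg.2 F.ratio_lt_one.le)) Metric.diam_nonneg))

variable [BoundedSpace X]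

theorem exp_geom_sum_le_distortionConst (n : ℕ) (x y : X) :
    Real.exp (F.distortion * ((∑ k ∈ Finset.range n, F.ratio ^ k) * dist x y)) ≤
      F.distortionConst := by
  have := F.distortion_nonneg
  have := inv_nonneg.2 (sub_nonneg.2 F.ratio_lt_one.le)
  unfold distortionConst
  gcongr
  · rw [← tsum_geometric_of_lt_one F.ratio_nonneg F.ratio_lt_one]
    exact (summable_geometric_of_lt_one F.ratio_nonneg F.ratio_lt_one).sum_le_tsum _
      fun k _ => pow_nonneg F.ratio_nonneg k
  · exact dist_le_diam_univ x y

theorem wordDeriv_mul_dist_le (w : Fin n → ι) (x y : X) :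
    F.wordDeriv n w x * dist x y ≤
      F.distortionConst * dist (F.wordMap n w x) (F.wordMap n w y) :=
  (F.wordDeriv_mul_dist_le_exp_geom_sum w x y).trans
    (mul_le_mul_of_nonneg_right (F.exp_geom_sum_le_distortionConst n x y) dist_nonneg)

theorem dist_wordMap_le_wordDeriv (w : Fin n → ι) (x y : X) :
    dist (F.wordMap n w x) (F.wordMap n w y) ≤
      F.distortionConst * (F.wordDeriv n w x * dist x y) :=
  (F.dist_wordMap_le_exp_geom_sum w x y).trans
    (mul_le_mul_of_nonneg_right (F.exp_geom_sum_le_distortionConst n x y)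
      (mul_nonneg (F.wordDeriv_pos w x).le dist_nonneg))

theorem wordDeriv_le_sq_mul_wordDeriv (w : Fin n → ι) (x z : X) :
    F.wordDeriv n w x ≤ F.distortionConst ^ 2 * F.wordDeriv n w z := by
  have hK := F.one_le_distortionConst
  rcases eq_or_ne x z with rfl | hxz
  · exact le_mul_of_one_le_left (F.wordDeriv_pos w x).le (one_le_pow₀ hK)
  · refine le_of_mul_le_mul_right ?_ (dist_pos.2 hxz)
    calc F.wordDeriv n w x * dist x z
        ≤ F.distortionConst * dist (F.wordMap n w x) (F.wordMap n w z) :=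
          F.wordDeriv_mul_dist_le w x z
      _ ≤ F.distortionConst * (F.distortionConst * (F.wordDeriv n w z * dist x z)) := by
          rw [dist_comm _ (F.wordMap n w z), dist_comm x]
          gcongr
          exact F.dist_wordMap_le_wordDeriv w z x
      _ = F.distortionConst ^ 2 * F.wordDeriv n w z * dist x z := by ring

theorem wordDeriv_mul_dist_le_cube_mul_dist (w : Fin n → ι) (x y z : X) :
    F.wordDeriv n w z * dist x y ≤
      F.distortionConst ^ 3 * dist (F.wordMap n w x) (F.wordMap n w y) := by
  have hK := F.one_le_distortionConst
  calc F.wordDeriv n w z * dist x y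
      ≤ F.distortionConst ^ 2 * (F.wordDeriv n w x * dist x y) := by
        rw [← mul_assoc]
        gcongr
        exact F.wordDeriv_le_sq_mul_wordDeriv w z x
    _ ≤ F.distortionConst ^ 2 *
          (F.distortionConst * dist (F.wordMap n w x) (F.wordMap n w y)) :=
        mul_le_mul_of_nonneg_left (F.wordDeriv_mul_dist_le w x y) (by positivity)
    _ = F.distortionConst ^ 3 * dist (F.wordMap n w x) (F.wordMap n w y) := by ring

theorem dist_wordMap_le_cube_mul (w : Fin n → ι) (x y z : X) :
    dist (F.wordMap n w x) (F.wordMap n w y) ≤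
      F.distortionConst ^ 3 * (F.wordDeriv n w z * dist x y) := by
  have hK := F.one_le_distortionConst
  calc dist (F.wordMap n w x) (F.wordMap n w y)
      ≤ F.distortionConst * (F.wordDeriv n w x * dist x y) := F.dist_wordMap_le_wordDeriv w x y
    _ ≤ F.distortionConst * (F.distortionConst ^ 2 * F.wordDeriv n w z * dist x y) := by
        gcongr
        exact F.wordDeriv_le_sq_mul_wordDeriv w x z
    _ = F.distortionConst ^ 3 * (F.wordDeriv n w z * dist x y) := by ring

theorem ediam_range_wordMap_rpow_le (w : Fin n → ι) (z : X) (t : ℝ≥0) :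
    Metric.ediam (Set.range (F.wordMap n w)) ^ (t : ℝ) ≤ ENNReal.ofReal
      ((F.distortionConst ^ 3 * Metric.diam (Set.univ : Set X)) ^ (t : ℝ) *
        F.wordDeriv n w z ^ (t : ℝ)) := by
  have hK := F.one_le_distortionConst
  have hw := F.wordDeriv_pos w z
  rw [← Real.mul_rpow (by positivity) hw.le,
    ← ENNReal.ofReal_rpow_of_nonneg (by positivity) t.coe_nonneg]
  gcongr
  refine Metric.ediam_le ?_
  rintro _ ⟨x, rfl⟩ _ ⟨y, rfl⟩
  rw [edist_dist]
  refine ENNReal.ofReal_le_ofReal ((F.dist_wordMap_le_cube_mul w x y z).trans ?_)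
  rw [mul_assoc, mul_comm (Metric.diam _)]
  gcongr
  exact dist_le_diam_univ x y

theorem ediam_range_wordMap_le (w : Fin n → ι) :
    Metric.ediam (Set.range (F.wordMap n w)) ≤
      ENNReal.ofReal (F.ratio ^ n * Metric.diam (Set.univ : Set X)) := by
  refine Metric.ediam_le ?_
  rintro _ ⟨x, rfl⟩ _ ⟨y, rfl⟩
  rw [edist_dist]
  exact ENNReal.ofReal_le_ofReal ((F.dist_wordMap_le w x y).trans
    (mul_le_mul_of_nonneg_left (dist_le_diam_univ x y) (pow_nonneg F.ratio_nonneg n)))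

theorem exists_le_dist_wordMap (n : ℕ) : ∃ g : ℝ, 0 < g ∧ ∀ v w : Fin n → ι, v ≠ w →
    ∀ x y, g ≤ dist (F.wordMap n v x) (F.wordMap n w y) := by
  induction n with
  | zero => exact ⟨1, one_pos, fun v w hvw => absurd (Subsingleton.elim v w) hvw⟩
  | succ n ih =>
    obtain ⟨g, hg, hsep⟩ := ih
    set E := Real.exp (F.distortion * Metric.diam (Set.univ : Set X))
    have hE : 0 < E := Real.exp_pos _
    refine ⟨min F.gap (F.minDeriv * g / E),
      lt_min F.gap_pos (div_pos (mul_pos F.minDeriv_pos hg) hE), fun v w hvw x y => ?_⟩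
    by_cases h₀ : v 0 = w 0
    · have htail : Fin.tail v ≠ Fin.tail w := fun h => hvw (by
        rw [← Fin.cons_self_tail v, ← Fin.cons_self_tail w, h₀, h])
      refine (min_le_right _ _).trans ((div_le_iff₀' hE).2 ?_)
      set x' := F.wordMap n (Fin.tail v) x
      set y' := F.wordMap n (Fin.tail w) y
      have := (F.deriv_pos (v 0) x').le
      calc F.minDeriv * g ≤ F.deriv (v 0) x' * dist x' y' :=
            mul_le_mul (F.minDeriv_le _ _) (hsep _ _ htail _ _) hg.le this
        _ ≤ E * dist (F.map (v 0) x') (F.map (v 0) y') := by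
            refine (F.deriv_mul_dist_le _ _ _).trans (mul_le_mul_of_nonneg_right ?_ dist_nonneg)
            exact Real.exp_le_exp.2
              (mul_le_mul_of_nonneg_left (dist_le_diam_univ x' y') F.distortion_nonneg)
        _ = E * dist (F.wordMap (n + 1) v x) (F.wordMap (n + 1) w y) := by
            rw [wordMap, wordMap, ← h₀]
    · exact (min_le_left _ _).trans (F.gap_le_dist _ _ h₀ _ _)

end Words

section TransferOperator

variable [Fintype ι]

/-- The transfer operator of the system at the exponent `t`. -/
noncomputable def transferOp (t : ℝ) (f : X → ℝ) (x : X) : ℝ :=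
  ∑ i, F.deriv i x ^ t * f (F.map i x)

variable {t : ℝ} {f : X → ℝ}

theorem transferOp_mono (t : ℝ) : Monotone (F.transferOp t) := fun _ _ hfg x =>
  Finset.sum_le_sum fun i _ =>
    mul_le_mul_of_nonneg_left (hfg _) (Real.rpow_nonneg (F.deriv_pos i x).le t)

theorem transferOp_smul (t c : ℝ) (f : X → ℝ) :
    F.transferOp t (c • f) = c • F.transferOp t f := by
  ext x
  simp only [transferOp, Pi.smul_apply, smul_eq_mul, Finset.mul_sum, mul_left_comm]

theorem iterate_transferOp (t : ℝ) (f : X → ℝ) (n : ℕ) (x : X) :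
    (F.transferOp t)^[n] f x = ∑ w : Fin n → ι, F.wordDeriv n w x ^ t * f (F.wordMap n w x) := by
  induction n generalizing f with
  | zero => simp [wordDeriv, wordMap]
  | succ n ih =>
    rw [Function.iterate_succ_apply, ih, ← (Fin.consEquiv fun _ => ι).sum_comp,
      Fintype.sum_prod_type_right]
    refine Finset.sum_congr rfl fun w _ => ?_
    rw [transferOp, Finset.mul_sum]
    refine Finset.sum_congr rfl fun i _ => ?_
    change _ = (F.deriv i (F.wordMap n w x) * F.wordDeriv n w x) ^ t *
      f (F.map i (F.wordMap n w x))
    rw [Real.mul_rpow (F.deriv_pos _ _).le (F.wordDeriv_pos _ _).le]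
    ring

theorem sum_wordDeriv_rpow_le {c : ℝ} (hc : 0 < c) (hcf : ∀ x, c ≤ f x)
    (hf : F.transferOp t f ≤ f) (n : ℕ) (x : X) :
    ∑ w : Fin n → ι, F.wordDeriv n w x ^ t ≤ f x / c := by
  rw [le_div_iff₀ hc, Finset.sum_mul]
  calc ∑ w : Fin n → ι, F.wordDeriv n w x ^ t * c
      ≤ ∑ w : Fin n → ι, F.wordDeriv n w x ^ t * f (F.wordMap n w x) :=
        Finset.sum_le_sum fun w _ => mul_le_mul_of_nonneg_left (hcf _)
          (Real.rpow_nonneg (F.wordDeriv_pos w x).le t)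
    _ = (F.transferOp t)^[n] f x := (F.iterate_transferOp t f n x).symm
    _ ≤ f x := (F.transferOp_mono t).antitone_iterate_of_map_le hf (Nat.zero_le n) x

theorem pow_smul_le_iterate_transferOp {c : ℝ} (hc : 0 ≤ c) (hf : c • f ≤ F.transferOp t f)
    (n : ℕ) : c ^ n • f ≤ (F.transferOp t)^[n] f := by
  induction n with
  | zero => rw [pow_zero, one_smul]; rfl
  | succ n ih =>
    rw [Function.iterate_succ_apply', pow_succ, mul_smul]
    calc c ^ n • c • f ≤ c ^ n • F.transferOp t f :=
          smul_le_smul_of_nonneg_left hf (pow_nonneg hc n)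
      _ = F.transferOp t (c ^ n • f) := (F.transferOp_smul t _ f).symm
      _ ≤ F.transferOp t ((F.transferOp t)^[n] f) := F.transferOp_mono t ih

theorem pow_mul_le_sum_wordDeriv_rpow {c C : ℝ} (hc : 0 ≤ c) (hf : c • f ≤ F.transferOp t f)
    (hC : 0 < C) (hfC : ∀ x, f x ≤ C) (n : ℕ) (x : X) :
    c ^ n * (f x / C) ≤ ∑ w : Fin n → ι, F.wordDeriv n w x ^ t := by
  rw [← mul_div_assoc, div_le_iff₀ hC, Finset.sum_mul]
  calc c ^ n * f x ≤ (F.transferOp t)^[n] f x := F.pow_smul_le_iterate_transferOp hc hf n x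
    _ = ∑ w : Fin n → ι, F.wordDeriv n w x ^ t * f (F.wordMap n w x) :=
        F.iterate_transferOp t f n x
    _ ≤ ∑ w : Fin n → ι, F.wordDeriv n w x ^ t * C :=
        Finset.sum_le_sum fun w _ => mul_le_mul_of_nonneg_left (hfC _)
          (Real.rpow_nonneg (F.wordDeriv_pos w x).le t)

/-- Lowering the exponent multiplies every weight `deriv i x ^ t` by at least
`ratio ^ (t' - t) > 1`. -/
theorem exists_one_lt_smul_le_transferOp {t' : ℝ} (ht : t' < t) (hratio : 0 < F.ratio)
    (hf₀ : 0 ≤ f) (hf : f ≤ F.transferOp t f) : ∃ c : ℝ, 1 < c ∧ c • f ≤ F.transferOp t' f := by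
  refine ⟨F.ratio ^ (t' - t), Real.one_lt_rpow_of_pos_of_lt_one_of_neg hratio F.ratio_lt_one
    (sub_neg.2 ht), fun x => ?_⟩
  calc F.ratio ^ (t' - t) * f x ≤ F.ratio ^ (t' - t) * F.transferOp t f x :=
        mul_le_mul_of_nonneg_left (hf x) (Real.rpow_nonneg hratio.le _)
    _ = ∑ i, F.ratio ^ (t' - t) * F.deriv i x ^ t * f (F.map i x) := by
        simp only [transferOp, Finset.mul_sum, mul_assoc]
    _ ≤ F.transferOp t' f x := by
        refine Finset.sum_le_sum fun i _ => mul_le_mul_of_nonneg_right ?_ (hf₀ _)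
        calc F.ratio ^ (t' - t) * F.deriv i x ^ t ≤ F.deriv i x ^ (t' - t) * F.deriv i x ^ t :=
              mul_le_mul_of_nonneg_right (Real.rpow_le_rpow_of_nonpos (F.deriv_pos i x)
                (F.deriv_le_ratio i x) (sub_neg.2 ht).le) (Real.rpow_nonneg (F.deriv_pos i x).le t)
          _ = F.deriv i x ^ t' := by rw [← Real.rpow_add (F.deriv_pos i x), sub_add_cancel]

end TransferOperator

section LimitSet

variable [BoundedSpace X] [CompleteSpace X] [Nonempty X]

/-- The point with symbolic address `a`, the limit of the images of a fixed base point under the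
compositions along the prefixes of `a`. -/
noncomputable def code (a : ℕ → ι) : X :=
  limUnder atTop fun n => F.wordMap n (fun i => a i) (Classical.arbitrary X)

/-- The limit set of the system. -/
def limitSet : Set X := Set.range F.code

theorem tendsto_code (a : ℕ → ι) (x : ℕ → X) :
    Tendsto (fun n => F.wordMap n (fun i => a i) (x n)) atTop (𝓝 (F.code a)) := by
  set u : ℕ → X := fun n => F.wordMap n (fun i => a i) (Classical.arbitrary X)
  set D := Metric.diam (Set.univ : Set X)
  have hdist : ∀ n y z, dist (F.wordMap n (fun i => a i) y) (F.wordMap n (fun i => a i) z) ≤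
      D * F.ratio ^ n := fun n y z => by
    rw [mul_comm]
    exact (F.dist_wordMap_le _ y z).trans
      (mul_le_mul_of_nonneg_left (dist_le_diam_univ y z) (pow_nonneg F.ratio_nonneg n))
  have hcauchy : CauchySeq u := cauchySeq_of_le_geometric _ D F.ratio_lt_one fun n => by
    rw [show u (n + 1) = F.wordMap n (fun i => a i) (F.map (a n) (Classical.arbitrary X)) from
      F.wordMap_succ_last _ _]
    exact hdist n _ _
  obtain ⟨l, hl⟩ := cauchySeq_tendsto_of_complete hcauchy
  refine (tendsto_nhds_limUnder ⟨l, hl⟩).congr_dist (squeeze_zero (fun _ => dist_nonneg)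
    (fun n => hdist n _ _) ?_)
  simpa using (tendsto_pow_atTop_nhds_zero_of_lt_one F.ratio_nonneg F.ratio_lt_one).const_mul D

theorem code_eq_map (a : ℕ → ι) : F.code a = F.map (a 0) (F.code fun n => a (n + 1)) :=
  tendsto_nhds_unique
    ((tendsto_add_atTop_iff_nat 1).2 (F.tendsto_code a fun _ => Classical.arbitrary X))
    (((F.continuous_map (a 0)).tendsto _).comp
      (F.tendsto_code (fun n => a (n + 1)) fun _ => Classical.arbitrary X))

theorem code_eq_wordMap (a : ℕ → ι) (n : ℕ) :
    F.code a = F.wordMap n (fun i => a i) (F.code fun k => a (k + n)) := by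
  induction n generalizing a with
  | zero => rfl
  | succ n ih => rw [F.code_eq_map a, ih fun k => a (k + 1)]; rfl

variable [Fintype ι] {t : ℝ≥0} {f : X → ℝ}

theorem dimH_limitSet_le {c : ℝ} (hc : 0 < c) (hcf : ∀ x, c ≤ f x)
    (hf : F.transferOp t f ≤ f) : dimH F.limitSet ≤ t := by
  obtain ⟨z⟩ := ‹Nonempty X›
  set M := (F.distortionConst ^ 3 * Metric.diam (Set.univ : Set X)) ^ (t : ℝ)
  refine dimH_le_of_finite_covers (C := (M * (f z / c)).toNNReal)
    (δ := fun n => ENNReal.ofReal (F.ratio ^ n * Metric.diam (Set.univ : Set X)))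
    (U := fun n (w : Fin n → ι) => Set.range (F.wordMap n w)) ?_ ?_
    (fun n w => F.ediam_range_wordMap_le w) fun n => ?_
  · have hlim := (tendsto_pow_atTop_nhds_zero_of_lt_one F.ratio_nonneg F.ratio_lt_one).mul_const
      (Metric.diam (Set.univ : Set X))
    rw [zero_mul] at hlim
    simpa using ENNReal.tendsto_ofReal hlim
  · rintro n _ ⟨a, rfl⟩
    exact Set.mem_iUnion.2 ⟨fun i => a i, _, (F.code_eq_wordMap a n).symm⟩
  · have hM : 0 ≤ M := Real.rpow_nonneg (mul_nonneg
      (pow_nonneg (zero_le_one.trans F.one_le_distortionConst) 3) Metric.diam_nonneg) _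
    calc ∑ w : Fin n → ι, Metric.ediam (Set.range (F.wordMap n w)) ^ (t : ℝ)
        ≤ ∑ w : Fin n → ι, ENNReal.ofReal (M * F.wordDeriv n w z ^ (t : ℝ)) :=
          Finset.sum_le_sum fun w _ => F.ediam_range_wordMap_rpow_le w z t
      _ = ENNReal.ofReal (M * ∑ w : Fin n → ι, F.wordDeriv n w z ^ (t : ℝ)) := by
          rw [Finset.mul_sum, ENNReal.ofReal_sum_of_nonneg fun w _ =>
            mul_nonneg hM (Real.rpow_nonneg (F.wordDeriv_pos w z).le _)]
      _ ≤ ENNReal.ofReal (M * (f z / c)) := by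
          gcongr
          exact F.sum_wordDeriv_rpow_le hc hcf hf n z

/-- An address for the system regroups into an address for the system of all words of a fixed
length, whose ratios are comparable to the word derivatives by bounded distortion. -/
theorem le_dimH_limitSet_of_one_le_sum {n : ℕ} (hn : n ≠ 0) (z : X) (ht : 0 < t)
    (hsum : 1 ≤ ∑ w : Fin n → ι, (F.wordDeriv n w z / F.distortionConst ^ 3) ^ (t : ℝ)) :
    (t : ℝ≥0∞) ≤ dimH F.limitSet := by
  have hn₀ : 0 < n := Nat.pos_of_ne_zero hn
  have hK : 1 ≤ F.distortionConst ^ 3 := one_le_pow₀ F.one_le_distortionConst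
  have hK₀ : 0 < F.distortionConst ^ 3 := one_pos.trans_le hK
  set regroup : (ℕ → Fin n → ι) → ℕ → ι := fun b k => b (k / n) ⟨k % n, Nat.mod_lt k hn₀⟩
  have hhead : ∀ b, (fun i : Fin n => regroup b i) = b 0 := fun b => by
    ext i
    simp only [regroup, Nat.div_eq_of_lt i.isLt, Nat.mod_eq_of_lt i.isLt]
  have hshift : ∀ b, (fun k => regroup b (k + n)) = regroup fun k => b (k + 1) := fun b => by
    ext k
    simp only [regroup, Nat.add_div_right k hn₀, Nat.add_mod_right]
  obtain ⟨g, hg, hsep⟩ := F.exists_le_dist_wordMap n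
  refine (le_dimH_range_of_one_le_sum_rpow (π := fun b => F.code (regroup b))
    (φ := fun w => F.wordMap n w) (fun b => ?_) ht hg
    (fun w => div_pos (F.wordDeriv_pos w z) hK₀)
    (fun w => ?_) (fun w x y => ?_) hsep hsum).trans (dimH_mono ?_)
  · rw [F.code_eq_wordMap _ n, hhead, hshift]
  · exact (div_le_self (F.wordDeriv_pos w z).le hK).trans_lt
      ((F.wordDeriv_le_ratio_pow w z).trans_lt (pow_lt_one₀ F.ratio_nonneg F.ratio_lt_one hn))
  · rw [div_mul_eq_mul_div, div_le_iff₀' hK₀]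
    exact F.wordDeriv_mul_dist_le_cube_mul_dist w x y z
  · exact Set.range_subset_iff.2 fun b => ⟨_, rfl⟩

theorem le_dimH_limitSet_of_smul_le {c C : ℝ} (hc : 1 < c) (hf₀ : ∀ x, 0 < f x)
    (hfC : ∀ x, f x ≤ C) (hf : c • f ≤ F.transferOp t f) : (t : ℝ≥0∞) ≤ dimH F.limitSet := by
  rcases eq_or_ne t 0 with rfl | ht
  · simp
  obtain ⟨z⟩ := ‹Nonempty X›
  have hK : 0 < F.distortionConst ^ 3 := pow_pos (one_pos.trans_le F.one_le_distortionConst) 3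
  have hC : 0 < C := (hf₀ z).trans_le (hfC z)
  have hKt := Real.rpow_pos_of_pos hK t
  obtain ⟨n, hn₀, hn⟩ := ((eventually_ne_atTop 0).and ((tendsto_pow_atTop_atTop_of_one_lt hc)
    |>.eventually_ge_atTop ((F.distortionConst ^ 3) ^ (t : ℝ) * (C / f z)))).exists
  refine F.le_dimH_limitSet_of_one_le_sum hn₀ z (pos_iff_ne_zero.2 ht) ?_
  simp only [Real.div_rpow (F.wordDeriv_pos _ z).le hK.le, ← Finset.sum_div]
  rw [one_le_div hKt]
  refine le_trans ?_ (F.pow_mul_le_sum_wordDeriv_rpow (zero_le_one.trans hc.le) hf hC hfC n z)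
  rwa [← div_le_iff₀ (div_pos (hf₀ z) hC), div_div_eq_mul_div, mul_div_assoc]

theorem le_dimH_limitSet {C : ℝ} (hf₀ : ∀ x, 0 < f x) (hfC : ∀ x, f x ≤ C)
    (hf : f ≤ F.transferOp t f) : (t : ℝ≥0∞) ≤ dimH F.limitSet := by
  obtain ⟨z⟩ := ‹Nonempty X›
  have : Nonempty ι := by
    by_contra h
    rw [not_nonempty_iff] at h
    exact absurd (hf z) (by simp [transferOp, hf₀ z])
  obtain ⟨i⟩ := this
  have hratio : 0 < F.ratio := (F.deriv_pos i z).trans_le (F.deriv_le_ratio i z)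
  refine ENNReal.le_of_forall_nnreal_lt fun t' ht' => ?_
  obtain ⟨c, hc, hcf⟩ := F.exists_one_lt_smul_le_transferOp (t' := t') (by exact_mod_cast ht')
    hratio (fun x => (hf₀ x).le) hf
  exact F.le_dimH_limitSet_of_smul_le hc hf₀ hfC hcf

end LimitSet

end ConformalIFS

section ContinuedFractions

theorem one_div_add_mem_Icc {m a : ℕ} (ha : a ∈ Set.Icc 1 m) {x : ℝ}
    (hx : x ∈ Set.Icc (0 : ℝ) 1) : 1 / (a + x) ∈ Set.Icc (1 / (m + 1) : ℝ) 1 := by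
  have h₁ : (1 : ℝ) ≤ a := by exact_mod_cast ha.1
  have hm : (a : ℝ) ≤ m := by exact_mod_cast ha.2
  exact ⟨one_div_le_one_div_of_le (by linarith [hx.1]) (by linarith [hx.2]),
    (div_le_one (by linarith [hx.1])).2 (by linarith [hx.1])⟩

theorem Icc_one_div_subset (m : ℕ) : Set.Icc (1 / (m + 1) : ℝ) 1 ⊆ Set.Icc 0 1 :=
  Set.Icc_subset_Icc_left (by positivity)

theorem dist_one_div_one_div {u v : ℝ} (hu : 0 < u) (hv : 0 < v) :
    dist (1 / u) (1 / v) = dist u v / (u * v) := by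
  rw [Real.dist_eq, Real.dist_eq, div_sub_div _ _ hu.ne' hv.ne', abs_div,
    abs_of_pos (mul_pos hu hv), one_mul, mul_one, abs_sub_comm]

theorem le_exp_dist_mul {u v : ℝ} (hu : 1 ≤ u) : v ≤ Real.exp (dist u v) * u := by
  have hexp := Real.add_one_le_exp (dist u v)
  rw [Real.dist_eq, abs_sub_comm] at *
  nlinarith [le_abs_self (v - u), abs_nonneg (v - u)]

theorem sq_inv_mul_dist_le {u v : ℝ} (hu : 1 ≤ u) (hv : 0 < v) :
    (u ^ 2)⁻¹ * dist u v ≤ Real.exp (dist u v) * dist (1 / u) (1 / v) := by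
  have hu₀ := one_pos.trans_le hu
  rw [dist_one_div_one_div hu₀ hv, inv_mul_eq_div, mul_div_assoc', div_le_div_iff₀ (by positivity)
    (by positivity)]
  calc dist u v * (u * v) ≤ dist u v * (u * (Real.exp (dist u v) * u)) := by
        gcongr
        exact le_exp_dist_mul hu
    _ = Real.exp (dist u v) * dist u v * u ^ 2 := by ring

theorem dist_one_div_le {u v : ℝ} (hu : 0 < u) (hv : 1 ≤ v) :
    dist (1 / u) (1 / v) ≤ Real.exp (dist u v) * ((u ^ 2)⁻¹ * dist u v) := by
  have hv₀ := one_pos.trans_le hv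
  rw [dist_one_div_one_div hu hv₀, inv_mul_eq_div, mul_div_assoc', div_le_div_iff₀ (by positivity)
    (by positivity)]
  calc dist u v * u ^ 2 ≤ dist u v * (u * (Real.exp (dist v u) * v)) := by
        rw [sq]
        gcongr
        exact le_exp_dist_mul hv
    _ = Real.exp (dist u v) * dist u v * (u * v) := by rw [dist_comm v]; ring

theorem one_sub_dist_le_dist_add_natCast {a b : ℕ} (hab : a ≠ b) (x y : ℝ) :
    1 - dist x y ≤ dist (a + x) (b + y) := by
  have hone : (1 : ℝ) ≤ |(a - b : ℝ)| := by
    exact_mod_cast Int.one_le_abs (sub_ne_zero.2 (Nat.cast_injective.ne hab : (a : ℤ) ≠ b))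
  have htri := abs_sub_abs_le_abs_sub (a - b : ℝ) (y - x)
  rw [Real.dist_eq, Real.dist_eq, abs_sub_comm x,
    show (a + x - (b + y) : ℝ) = a - b - (y - x) by ring]
  linarith

theorem natCast_add_mem_Icc {m a : ℕ} (ha : a ∈ Set.Icc 1 m) {x : ℝ}
    (hx : x ∈ Set.Icc (1 / (m + 1) : ℝ) 1) : a + x ∈ Set.Icc (1 + 1 / (m + 1) : ℝ) (m + 1) :=
  ⟨add_le_add (by exact_mod_cast ha.1) hx.1, add_le_add (by exact_mod_cast ha.2) hx.2⟩

theorem one_le_natCast_add {m a : ℕ} (ha : a ∈ Set.Icc 1 m) {x : ℝ}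
    (hx : x ∈ Set.Icc (1 / (m + 1) : ℝ) 1) : 1 ≤ a + x :=
  (le_add_of_nonneg_right (by positivity)).trans (natCast_add_mem_Icc ha hx).1

/-- The inverse branches `x ↦ 1 / (a + x)`, `1 ≤ a ≤ m`, of the Gauss map, on the interval
`[1 / (m + 1), 1]`, where they contract uniformly and their images are separated. -/
noncomputable def gaussIFS (m : ℕ) :
    ConformalIFS (Set.Icc 1 m) (Set.Icc (1 / (m + 1) : ℝ) 1) where
  map a x := ⟨1 / ((a : ℕ) + x), one_div_add_mem_Icc a.2 (Icc_one_div_subset m x.2)⟩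
  deriv a x := (((a : ℕ) + x : ℝ) ^ 2)⁻¹
  ratio := ((1 + 1 / (m + 1)) ^ 2)⁻¹
  distortion := 1
  minDeriv := ((m + 1) ^ 2)⁻¹
  gap := 1 / (m + 1) / (m + 1) ^ 2
  ratio_nonneg := by positivity
  ratio_lt_one :=
    inv_lt_one_of_one_lt₀ (one_lt_pow₀ (lt_add_of_pos_right 1 (by positivity)) two_ne_zero)
  distortion_nonneg := zero_le_one
  minDeriv_pos := by positivity
  gap_pos := by positivity
  minDeriv_le a x := by
    have hx := one_pos.trans_le (one_le_natCast_add a.2 x.2)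
    exact inv_anti₀ (pow_pos hx 2) (pow_le_pow_left₀ hx.le (natCast_add_mem_Icc a.2 x.2).2 2)
  deriv_le_ratio a x :=
    inv_anti₀ (by positivity)
      (pow_le_pow_left₀ (by positivity) (natCast_add_mem_Icc a.2 x.2).1 2)
  dist_map_le a x y := by
    have hx := natCast_add_mem_Icc a.2 x.2
    have hy := natCast_add_mem_Icc a.2 y.2
    rw [Subtype.dist_eq, dist_one_div_one_div (one_pos.trans_le (one_le_natCast_add a.2 x.2))
      (one_pos.trans_le (one_le_natCast_add a.2 y.2)), dist_add_left, div_eq_inv_mul, sq]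
    exact mul_le_mul_of_nonneg_right
      (inv_anti₀ (by positivity)
        (mul_le_mul hx.1 hy.1 (by positivity) (le_trans (by positivity) hx.1))) dist_nonneg
  deriv_mul_dist_le a x y := by
    simpa only [Subtype.dist_eq, dist_add_left, one_mul] using
      sq_inv_mul_dist_le (one_le_natCast_add a.2 x.2)
        (one_pos.trans_le (one_le_natCast_add a.2 y.2))
  dist_map_le_deriv a x y := by
    simpa only [Subtype.dist_eq, dist_add_left, one_mul] using
      dist_one_div_le (one_pos.trans_le (one_le_natCast_add a.2 x.2))
        (one_le_natCast_add a.2 y.2)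
  gap_le_dist a b hab x y := by
    have hx := natCast_add_mem_Icc a.2 x.2
    have hy := natCast_add_mem_Icc b.2 y.2
    have hx₀ := one_pos.trans_le (one_le_natCast_add a.2 x.2)
    have hy₀ := one_pos.trans_le (one_le_natCast_add b.2 y.2)
    have hxy : dist (x : ℝ) y ≤ 1 - 1 / (m + 1) := Real.dist_le_of_mem_Icc x.2 y.2
    have hdist := one_sub_dist_le_dist_add_natCast (Subtype.coe_injective.ne hab) (x : ℝ) y
    rw [Subtype.dist_eq, dist_one_div_one_div hx₀ hy₀, sq]
    exact div_le_div₀ dist_nonneg (by linarith) (mul_pos hx₀ hy₀)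
      (mul_le_mul hx.2 hy.2 hy₀.le (by positivity))

theorem convs_regularContFract_zero (a : ℕ → ℕ) : (regularContFract a).convs 0 = 0 := by
  simp [regularContFract]

theorem convs_regularContFract_succ {a : ℕ → ℕ} (ha : ∀ n, 1 ≤ a n) (n : ℕ) :
    (regularContFract a).convs (n + 1) =
      1 / (a 0 + (regularContFract fun k => a (k + 1)).convs n) := by
  have convs_eq : ∀ {b : ℕ → ℕ}, (∀ n, 1 ≤ b n) → ∀ n,
      (regularContFract b).convs n = GenContFract.convs'Aux (regularContFract b).s n := by
    intro b hb n
    rw [GenContFract.convs_eq_convs', GenContFract.convs']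
    · exact zero_add _
    · intro gp k _ hk
      obtain rfl : ⟨1, (b k : ℝ)⟩ = gp := Option.some.inj hk
      exact ⟨one_pos, Nat.cast_pos.2 (hb k)⟩
  rw [convs_eq ha, convs_eq fun k => ha (k + 1),
    GenContFract.convs'Aux_succ_some
      (show (regularContFract a).s.head = some ⟨1, (a 0 : ℝ)⟩ from rfl)]
  rfl

theorem convs_regularContFract_succ_eq_wordMap {m : ℕ} (a : ℕ → Set.Icc 1 m) (n : ℕ) :
    (regularContFract fun k => a k).convs (n + 1) =
      (gaussIFS m).wordMap n (fun i => a i)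
        ⟨1 / ((a n : ℕ) + 0), one_div_add_mem_Icc (a n).2 (Set.left_mem_Icc.2 zero_le_one)⟩ := by
  induction n generalizing a with
  | zero =>
    rw [convs_regularContFract_succ fun k => (a k).2.1, convs_regularContFract_zero]
    rfl
  | succ n ih =>
    rw [convs_regularContFract_succ fun k => (a k).2.1, ih fun k => a (k + 1)]
    rfl

instance nonempty_Icc_one_div (m : ℕ) : Nonempty (Set.Icc (1 / (m + 1) : ℝ) 1) :=
  ⟨1, (div_le_one (by positivity)).2 (le_add_of_nonneg_left m.cast_nonneg), le_rfl⟩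

theorem contFractSet_eq_image_limitSet (m : ℕ) :
    contFractSet m = Subtype.val '' (gaussIFS m).limitSet := by
  have hconvs : ∀ a : ℕ → Set.Icc 1 m, Tendsto (regularContFract fun k => a k).convs atTop
      (𝓝 ((gaussIFS m).code a)) := fun a => by
    refine (tendsto_add_atTop_iff_nat 1).1 (Tendsto.congr
      (fun n => (convs_regularContFract_succ_eq_wordMap a n).symm) ?_)
    exact (continuous_subtype_val.tendsto _).comp ((gaussIFS m).tendsto_code a _)
  ext x
  constructor
  · rintro ⟨a, ha, hx⟩
    exact ⟨_, ⟨fun k => ⟨a k, ha k⟩, rfl⟩,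
      tendsto_nhds_unique (hconvs fun k => ⟨a k, ha k⟩) hx⟩
  · rintro ⟨_, ⟨a, rfl⟩, rfl⟩
    exact ⟨fun k => a k, fun k => (a k).2, hconvs a⟩

theorem dimH_contFractSet_eq (m : ℕ) : dimH (contFractSet m) = dimH (gaussIFS m).limitSet := by
  rw [contFractSet_eq_image_limitSet, isometry_subtype_coe.dimH_image]

/-- The transfer operator of the Gauss map restricted to the digits `1, …, m`; at the parameter
`s = 2 t` it is the transfer operator of `gaussIFS m` at the exponent `t`. -/
noncomputable def gaussTransfer (m : ℕ) (s : ℝ) (f : ℝ → ℝ) (x : ℝ) : ℝ :=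
  ∑ a ∈ Finset.Icc 1 m, (a + x) ^ (-s) * f (1 / (a + x))

theorem transferOp_gaussIFS {m : ℕ} (t : ℝ) (f : ℝ → ℝ) (x : Set.Icc (1 / (m + 1) : ℝ) 1) :
    (gaussIFS m).transferOp t (fun y => f y) x = gaussTransfer m (2 * t) f x := by
  rw [gaussTransfer, Finset.sum_subtype (p := (· ∈ Set.Icc 1 m)) _ fun a => by simp]
  refine Finset.sum_congr rfl fun a _ => congrArg (· * _) ?_
  have ha := (one_pos.trans_le (one_le_natCast_add a.2 x.2)).le
  change (((a : ℕ) + x : ℝ) ^ 2)⁻¹ ^ t = _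
  rw [Real.inv_rpow (by positivity), ← Real.rpow_natCast, ← Real.rpow_mul ha, Real.rpow_neg ha]
  rfl

theorem dimH_contFractSet_le {m : ℕ} {t : ℝ≥0} {f : ℝ → ℝ} {c : ℝ} (hc : 0 < c)
    (hcf : ∀ x ∈ Set.Icc (0 : ℝ) 1, c ≤ f x)
    (hf : ∀ x ∈ Set.Icc (0 : ℝ) 1, gaussTransfer m (2 * t) f x ≤ f x) :
    dimH (contFractSet m) ≤ t := by
  rw [dimH_contFractSet_eq]
  refine (gaussIFS m).dimH_limitSet_le (f := fun x => f x) hc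
    (fun x => hcf x (Icc_one_div_subset m x.2)) fun x => ?_
  rw [transferOp_gaussIFS]
  exact hf x (Icc_one_div_subset m x.2)

theorem le_dimH_contFractSet {m : ℕ} {t : ℝ≥0} {f : ℝ → ℝ} {C : ℝ}
    (hf₀ : ∀ x ∈ Set.Icc (0 : ℝ) 1, 0 < f x) (hfC : ∀ x ∈ Set.Icc (0 : ℝ) 1, f x ≤ C)
    (hf : ∀ x ∈ Set.Icc (0 : ℝ) 1, f x ≤ gaussTransfer m (2 * t) f x) :
    (t : ℝ≥0∞) ≤ dimH (contFractSet m) := by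
  rw [dimH_contFractSet_eq]
  refine (gaussIFS m).le_dimH_limitSet (f := fun x => f x)
    (fun x => hf₀ x (Icc_one_div_subset m x.2)) (fun x => hfC x (Icc_one_div_subset m x.2))
    fun x => ?_
  rw [transferOp_gaussIFS]
  exact hf x (Icc_one_div_subset m x.2)

end ContinuedFractions

section CoefficientLists

/-- The value at `z` of the polynomial with integer coefficients `p`, constant term first. -/
def evalList {R : Type*} [CommRing R] (p : List ℤ) (z : R) : R :=
  p.foldr (fun (c : ℤ) (v : R) => (c : R) + z * v) 0

/-- The coefficients of the sum of two polynomials. -/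
def addList : List ℤ → List ℤ → List ℤ
  | [], q => q
  | p, [] => p
  | c :: p, d :: q => (c + d) :: addList p q

/-- The coefficients of the product of a polynomial by the constant `k`. -/
def smulList (k : ℤ) (p : List ℤ) : List ℤ := p.map (k * ·)

/-- The coefficients of the product of a polynomial by `m + z`. -/
def mulLinear (m : ℤ) (p : List ℤ) : List ℤ := addList (smulList m p) (0 :: p)

/-- The coefficients of the derivative of a polynomial. -/
def derivList : List ℤ → List ℤ
  | [] => []
  | _ :: p => addList p (0 :: derivList p)

/-- The sum of the absolute values of the coefficients of a polynomial. -/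
def normList (p : List ℤ) : ℕ := (p.map Int.natAbs).sum

section Algebra

variable {R : Type*} [CommRing R] (z : R)

@[simp] theorem evalList_nil : evalList [] z = 0 := rfl

@[simp] theorem evalList_cons (c : ℤ) (p : List ℤ) :
    evalList (c :: p) z = c + z * evalList p z := rfl

@[simp] theorem evalList_addList (p q : List ℤ) :
    evalList (addList p q) z = evalList p z + evalList q z := by
  fun_induction addList p q with
  | case1 q => rw [evalList_nil, zero_add]
  | case2 p => rw [evalList_nil, add_zero]
  | case3 c p d q ih => simp only [evalList_cons, ih]; push_cast; ring

@[simp] theorem evalList_smulList (k : ℤ) (p : List ℤ) :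
    evalList (smulList k p) z = k * evalList p z := by
  induction p with
  | nil => exact (mul_zero _).symm
  | cons c p ih =>
    rw [smulList, List.map_cons, evalList_cons, ← smulList, ih, evalList_cons]
    push_cast
    ring

@[simp] theorem evalList_mulLinear (m : ℤ) (p : List ℤ) :
    evalList (mulLinear m p) z = (m + z) * evalList p z := by
  simp [mulLinear, add_mul]

theorem evalList_intCast (p : List ℤ) (k : ℤ) : evalList p (k : R) = (evalList p k : ℤ) := by
  induction p with
  | nil => simp
  | cons c p ih => simp [ih]

end Algebra

theorem hasDerivAt_evalList (p : List ℤ) (z : ℝ) :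
    HasDerivAt (evalList p) (evalList (derivList p) z) z := by
  induction p with
  | nil => exact hasDerivAt_const z (0 : ℝ)
  | cons c p ih =>
    refine (((hasDerivAt_id z).mul ih).const_add (c : ℝ)).congr_deriv ?_
    simp [derivList]

theorem normList_cons (c : ℤ) (p : List ℤ) : (normList (c :: p) : ℝ) = |(c : ℝ)| + normList p := by
  simp [normList, Nat.cast_natAbs]

theorem abs_evalList_le (p : List ℤ) {z : ℝ} (hz : |z| ≤ 1) : |evalList p z| ≤ normList p := by
  induction p with
  | nil => simp
  | cons c p ih =>
    calc |(c : ℝ) + z * evalList p z| ≤ |(c : ℝ)| + |z| * |evalList p z| := by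
          rw [← abs_mul]
          exact abs_add_le _ _
      _ ≤ |(c : ℝ)| + 1 * normList p := by gcongr
      _ = normList (c :: p) := by rw [one_mul, normList_cons]

end CoefficientLists

/-- A function on `[-1, 1]` approximated by an integer polynomial up to a uniform integer error. -/
structure TaylorModel where
  coeffs : List ℤ
  error : ℤ

namespace TaylorModel

/-- The function `g` stays within the error of the model on `[-1, 1]`. -/
def Encloses (M : TaylorModel) (g : ℝ → ℝ) : Prop :=
  ∀ z, |z| ≤ 1 → |g z - evalList M.coeffs z| ≤ M.error

/-- The model of a polynomial, without error. -/
def ofList (p : List ℤ) : TaylorModel := ⟨p, 0⟩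

/-- The model of a sum. -/
def add (M N : TaylorModel) : TaylorModel := ⟨addList M.coeffs N.coeffs, M.error + N.error⟩

/-- The model of a difference. -/
def sub (M N : TaylorModel) : TaylorModel :=
  ⟨addList M.coeffs (smulList (-1) N.coeffs), M.error + N.error⟩

/-- The model of the product by the rational number `f / S`, with coefficients rounded to integers
and the rounding error measured through the exact residual. -/
def scale (S f : ℤ) (M : TaylorModel) : TaylorModel :=
  let p := M.coeffs.map (· * f / S)
  ⟨p, M.error + (normList (addList (smulList f M.coeffs) (smulList (-S) p)) / S + 1)⟩

/-- Rounded coefficients of the power series of the quotient by `m + z` of the polynomial `p`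
diminished by the constant `b`. -/
def divLinear (m : ℤ) : ℤ → List ℤ → List ℤ
  | _, [] => []
  | b, c :: p => (c - b) / m :: divLinear m ((c - b) / m) p

/-- The model of the product by the Möbius function `4 / (m + z) - 1`, which is bounded by `1` on
`[-1, 1]` for `3 ≤ m`, so that the error is only increased by the rounding. -/
def mulMobius (m : ℤ) (M : TaylorModel) : TaylorModel :=
  let p := smulList 4 M.coeffs
  let d := divLinear m 0 p
  ⟨addList d (smulList (-1) M.coeffs),
    M.error + normList (addList p (smulList (-1) (mulLinear m d)))⟩

/-- The model of `w z * p (4 / (m + z) - 1)`, where `U` is a model of `S * w`, by Horner's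
scheme. -/
def hornerMobius (S m : ℤ) (U : TaylorModel) (p : List ℤ) : TaylorModel :=
  p.foldr (fun f M => (U.scale S f).add (M.mulMobius m)) (ofList [])

/-- A lower bound for the functions enclosed by the model. -/
def lower (M : TaylorModel) : ℤ := M.coeffs.headI - normList M.coeffs.tail - M.error

variable {M N : TaylorModel} {g h : ℝ → ℝ}

theorem ofList_encloses (p : List ℤ) : (ofList p).Encloses (evalList p) := fun z _ => by
  simp [ofList]

theorem Encloses.add (hM : M.Encloses g) (hN : N.Encloses h) :
    (M.add N).Encloses fun z => g z + h z := fun z hz => by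
  rw [TaylorModel.add, evalList_addList, add_sub_add_comm, Int.cast_add]
  exact (abs_add_le _ _).trans (add_le_add (hM z hz) (hN z hz))

theorem Encloses.sub (hM : M.Encloses g) (hN : N.Encloses h) :
    (M.sub N).Encloses fun z => g z - h z := fun z hz => by
  have hsplit : g z - h z - evalList (M.sub N).coeffs z =
      g z - evalList M.coeffs z - (h z - evalList N.coeffs z) := by
    simp only [TaylorModel.sub, evalList_addList, evalList_smulList]
    push_cast
    ring
  rw [hsplit, TaylorModel.sub, Int.cast_add]
  exact (abs_sub _ _).trans (add_le_add (hM z hz) (hN z hz))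

theorem intCast_div_le_ediv_add_one (k : ℤ) {d : ℤ} (hd : 0 < d) :
    (k / d : ℝ) ≤ (k / d : ℤ) + 1 := by
  have hd' : (0 : ℝ) < d := by exact_mod_cast hd
  rw [div_le_iff₀ hd']
  exact_mod_cast (Int.lt_ediv_add_one_mul_self k hd).le

theorem Encloses.scale {S f : ℤ} (hS : 0 < S) (hf : |f| ≤ S) (hM : M.Encloses g) :
    (M.scale S f).Encloses fun z => f / S * g z := fun z hz => by
  set p := M.coeffs.map (· * f / S)
  set r := addList (smulList f M.coeffs) (smulList (-S) p)
  have hS' : (0 : ℝ) < S := by exact_mod_cast hS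
  have hfS : |(f / S : ℝ)| ≤ 1 := by
    rw [abs_div, abs_of_pos hS', div_le_one hS']
    exact_mod_cast hf
  have hsplit : f / S * g z - evalList p z =
      f / S * (g z - evalList M.coeffs z) + evalList r z / S := by
    simp only [r, evalList_addList, evalList_smulList]
    push_cast
    field_simp
    ring
  calc |f / S * g z - evalList p z|
      ≤ |(f / S : ℝ)| * |g z - evalList M.coeffs z| + |evalList r z| / S := by
        rw [hsplit, ← abs_mul, ← abs_of_pos hS', ← abs_div, abs_of_pos hS']
        exact abs_add_le _ _
    _ ≤ 1 * M.error + ((normList r : ℤ) : ℝ) / S := by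
        gcongr
        exacts [hM z hz, by exact_mod_cast abs_evalList_le r hz]
    _ ≤ M.error + ((normList r / S : ℤ) + 1) := by
        rw [one_mul]
        gcongr
        exact intCast_div_le_ediv_add_one _ hS
    _ = (M.scale S f).error := by
        simp only [TaylorModel.scale, Int.cast_add, Int.cast_one, p, r]

theorem Encloses.mulMobius {m : ℤ} (hm : 3 ≤ m) (hM : M.Encloses g) :
    (M.mulMobius m).Encloses fun z => (4 / (m + z) - 1) * g z := fun z hz => by
  set p := smulList 4 M.coeffs
  set d := divLinear m 0 p
  set r := addList p (smulList (-1) (mulLinear m d))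
  have hm' : (3 : ℝ) ≤ m := by exact_mod_cast hm
  have hmz : 2 ≤ m + z := by linarith [(abs_le.1 hz).1]
  have hmz₀ : 0 < m + z := by linarith
  have hfactor : |4 / (m + z) - 1| ≤ 1 := by
    have : 4 / (m + z) ≤ 2 := (div_le_iff₀ hmz₀).2 (by linarith)
    rw [abs_le]
    constructor <;> linarith [div_pos four_pos hmz₀]
  have hsplit : (4 / (m + z) - 1) * g z - evalList (M.mulMobius m).coeffs z =
      (4 / (m + z) - 1) * (g z - evalList M.coeffs z) + evalList r z / (m + z) := by
    simp only [TaylorModel.mulMobius, r, d, p, evalList_addList, evalList_smulList,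
      evalList_mulLinear]
    push_cast
    field_simp
    ring
  calc |(4 / (m + z) - 1) * g z - evalList (M.mulMobius m).coeffs z|
      ≤ |4 / (m + z) - 1| * |g z - evalList M.coeffs z| + |evalList r z| / (m + z) := by
        rw [hsplit, ← abs_mul, ← abs_of_pos hmz₀, ← abs_div, abs_of_pos hmz₀]
        exact abs_add_le _ _
    _ ≤ 1 * M.error + normList r := by
        gcongr
        exacts [hM z hz, (div_le_self (abs_nonneg _) (by linarith)).trans (abs_evalList_le r hz)]
    _ = (M.mulMobius m).error := by
        simp only [TaylorModel.mulMobius, one_mul, Int.cast_add, Int.cast_natCast, r, d, p]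

theorem Encloses.hornerMobius {S m : ℤ} (hS : 0 < S) (hm : 3 ≤ m) {U : TaylorModel} {w : ℝ → ℝ}
    (hU : U.Encloses fun z => S * w z) {p : List ℤ} (hp : ∀ f ∈ p, |f| ≤ S) :
    (U.hornerMobius S m p).Encloses fun z => w z * evalList p (4 / (m + z) - 1) := by
  induction p with
  | nil => exact fun z _ => by simp [TaylorModel.hornerMobius, ofList]
  | cons f p ih =>
    have hS' : (S : ℝ) ≠ 0 := by exact_mod_cast hS.ne'
    have hstep := (hU.scale hS (hp f List.mem_cons_self)).add
      ((ih fun f hf => hp f (List.mem_cons_of_mem _ hf)).mulMobius hm)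
    have hcons : (fun z => w z * evalList (f :: p) (4 / (m + z) - 1)) = fun z =>
        f / S * (S * w z) + (4 / (m + z) - 1) * (w z * evalList p (4 / (m + z) - 1)) := by
      funext z
      rw [evalList_cons]
      field_simp
    rw [hcons]
    exact hstep

theorem Encloses.lower_le (hM : M.Encloses g) {z : ℝ} (hz : |z| ≤ 1) : M.lower ≤ g z := by
  obtain ⟨p, e⟩ := M
  have htail : |z * evalList p.tail z| ≤ normList p.tail := by
    rw [abs_mul]
    exact (mul_le_of_le_one_left (abs_nonneg _) hz).trans (abs_evalList_le _ hz)
  have hp : evalList p z = p.headI + z * evalList p.tail z := by cases p <;> simp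
  have hg := hM z hz
  rw [hp] at hg
  simp only [lower]
  push_cast
  linarith [(abs_le.1 hg).1, (abs_le.1 htail).1]

end TaylorModel

section Powers

/-- The power `c * x ^ (-s)` is the solution of `x * u' + s * u = 0` with its value at `a`, so the
residual of this equation controls the distance of any other function from it. -/
theorem abs_mul_rpow_neg_sub_le {u u' : ℝ → ℝ} {a x s c N : ℝ} (ha : 0 < a) (hax : a ≤ x)
    (hs : 0 ≤ s) (hu : ∀ y ∈ Set.Icc a x, HasDerivAt u (u' y) y)
    (hN : ∀ y ∈ Set.Icc a x, |y * u' y + s * u y| ≤ N) :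
    |c * x ^ (-s) - u x| ≤ |c * a ^ (-s) - u a| + N / a * (x - a) := by
  have hpos : ∀ y ∈ Set.Icc a x, 0 < y := fun y hy => ha.trans_le hy.1
  have hx := ha.trans_le hax
  have hderiv : ∀ y ∈ Set.Icc a x, HasDerivAt (fun y => y ^ s * u y - c)
      (y ^ s / y * (y * u' y + s * u y)) y := fun y hy => by
    refine (((Real.hasDerivAt_rpow_const (.inl (hpos y hy).ne')).mul (hu y hy)).sub_const
      c).congr_deriv ?_
    rw [Real.rpow_sub_one (hpos y hy).ne']
    field_simp [(hpos y hy).ne']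
    ring
  have hbound : ∀ y ∈ Set.Icc a x, ‖y ^ s / y * (y * u' y + s * u y)‖ ≤ x ^ s / a * N :=
    fun y hy => by
      have hy₀ := hpos y hy
      rw [norm_mul, Real.norm_of_nonneg (by positivity), Real.norm_eq_abs]
      gcongr
      exacts [hy.2, hy.1, hN y hy]
  have hmean := (convex_Icc a x).norm_image_sub_le_of_norm_hasDerivWithin_le
    (fun y hy => (hderiv y hy).hasDerivWithinAt) hbound ⟨le_rfl, hax⟩ ⟨hax, le_rfl⟩
  have hmul : ∀ y, 0 < y → |y ^ s * u y - c| = y ^ s * |c * y ^ (-s) - u y| := fun y hy => by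
    rw [← abs_of_pos (Real.rpow_pos_of_pos hy s), ← abs_mul, abs_sub_comm,
      abs_of_pos (Real.rpow_pos_of_pos hy s), Real.rpow_neg hy.le]
    field_simp
  rw [Real.norm_eq_abs, Real.norm_eq_abs, abs_of_nonneg (sub_nonneg.2 hax)] at hmean
  refine le_of_mul_le_mul_left ?_ (Real.rpow_pos_of_pos hx s)
  calc x ^ s * |c * x ^ (-s) - u x|
      ≤ |a ^ s * u a - c| + x ^ s / a * N * (x - a) := by
        rw [← hmul x hx]
        linarith [abs_sub_abs_le_abs_sub (x ^ s * u x - c) (a ^ s * u a - c)]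
    _ ≤ x ^ s * |c * a ^ (-s) - u a| + x ^ s / a * N * (x - a) := by
        rw [hmul a ha]
        gcongr
    _ = x ^ s * (|c * a ^ (-s) - u a| + N / a * (x - a)) := by ring

/-- Rounded coefficients of order `k, …, k + n` of the power series with leading coefficient `u`
that is annihilated by `q * (m + z) * d/dz + p`, hence proportional to `(m + z) ^ (-p / q)`. -/
def powCoeffs (p q m : ℤ) : ℕ → ℤ → ℤ → List ℤ
  | 0, _, u => [u]
  | n + 1, k, u => u :: powCoeffs p q m n (k + 1) (-((p + k * q) * u) / (m * (k + 1) * q))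

/-- The coefficients of the image of a polynomial under `q * (m + z) * d/dz + p`. -/
def powResidual (p q m : ℤ) (U : List ℤ) : List ℤ :=
  addList (smulList q (mulLinear m (derivList U))) (smulList p U)

theorem abs_mul_rpow_neg_sub_evalList_le {p q : ℕ} (hq : 0 < q) {a : ℤ} (ha : 1 ≤ a)
    (U : List ℤ) (c : ℝ) {z : ℝ} (hz : |z| ≤ 1) :
    |c * (a + (1 + z) / 2) ^ (-(p / q : ℝ)) - evalList U z| ≤
      |c * (a : ℝ) ^ (-(p / q : ℝ)) - evalList U (-1 : ℝ)| +
        normList (powResidual p q (2 * a + 1) U) / q := by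
  obtain ⟨hz₁, hz₂⟩ := abs_le.1 hz
  have ha' : (1 : ℝ) ≤ a := by exact_mod_cast ha
  have hq' : (0 : ℝ) < q := by exact_mod_cast hq
  set N := normList (powResidual p q (2 * a + 1) U) with hN
  have hderiv (y : ℝ) : HasDerivAt (fun y : ℝ => evalList U (2 * y - (2 * a + 1)))
      (2 * evalList (derivList U) (2 * y - (2 * a + 1))) y := by
    have haffine : HasDerivAt (fun y : ℝ => 2 * y - (2 * a + 1)) 2 y := by
      simpa using ((hasDerivAt_id y).const_mul 2).sub_const (2 * a + 1 : ℝ)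
    exact ((hasDerivAt_evalList U _).comp y haffine).congr_deriv (mul_comm _ _)
  have hresidual : ∀ y ∈ Set.Icc (a : ℝ) (a + (1 + z) / 2),
      |y * (2 * evalList (derivList U) (2 * y - (2 * a + 1))) +
        p / q * evalList U (2 * y - (2 * a + 1))| ≤ N / q := fun y hy => by
    have hy' : |2 * y - (2 * a + 1)| ≤ 1 := abs_le.2 ⟨by linarith [hy.1], by linarith [hy.2]⟩
    rw [le_div_iff₀ hq', ← abs_of_pos hq', ← abs_mul, abs_of_pos hq', hN]
    refine le_of_eq_of_le (congrArg _ ?_) (abs_evalList_le _ hy')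
    simp only [powResidual, evalList_addList, evalList_smulList, evalList_mulLinear]
    push_cast
    field_simp
    ring
  have hbound := abs_mul_rpow_neg_sub_le (c := c) (one_pos.trans_le ha')
    (by linarith : (a : ℝ) ≤ a + (1 + z) / 2) (by positivity : (0 : ℝ) ≤ p / q)
    (fun y _ => hderiv y) hresidual
  rw [show 2 * (a + (1 + z) / 2) - (2 * a + 1) = z by ring,
    show 2 * a - (2 * a + 1) = (-1 : ℝ) by ring, add_sub_cancel_left] at hbound
  refine hbound.trans (add_le_add_right ?_ _)
  rw [div_mul_eq_mul_div]
  exact div_le_of_le_mul₀ (by linarith) (by positivity)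
    (mul_le_mul_of_nonneg_left (by linarith) (by positivity))

namespace TaylorModel

/-- The model of `S * (a + (1 + z) / 2) ^ (-p / q)`, where `S * a ^ (-p / q)` is known to be `v` up
to `e`. The leading coefficient is chosen so that the value at `z = -1` is close to `v`. -/
def powStep (p q n : ℕ) (a v e : ℤ) : TaylorModel :=
  let m := 2 * a + 1
  let U := powCoeffs p q m n 0 (v * v / evalList (powCoeffs p q m n 0 v) (-1))
  ⟨U, |v - evalList U (-1)| + e + (normList (powResidual p q m U) / q + 1)⟩

theorem powStep_encloses {p q n : ℕ} {a v e S : ℤ} (hq : 0 < q) (ha : 1 ≤ a)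
    (hv : |S * (a : ℝ) ^ (-(p / q : ℝ)) - v| ≤ e) :
    (powStep p q n a v e).Encloses fun z => S * (a + (1 + z) / 2) ^ (-(p / q : ℝ)) :=
  fun z hz => by
    set U := (powStep p q n a v e).coeffs
    set N := normList (powResidual p q (2 * a + 1) U)
    have hU : evalList U (-1 : ℝ) = (evalList U (-1) : ℤ) := by
      simpa using evalList_intCast (R := ℝ) U (-1)
    calc |S * (a + (1 + z) / 2) ^ (-(p / q : ℝ)) - evalList U z|
        ≤ |S * (a : ℝ) ^ (-(p / q : ℝ)) - evalList U (-1 : ℝ)| + ((N : ℤ) / (q : ℤ) : ℝ) :=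
          abs_mul_rpow_neg_sub_evalList_le hq ha U S hz
      _ ≤ (e + |(v : ℝ) - (evalList U (-1) : ℤ)|) + ((N / q : ℤ) + 1) := by
          rw [hU]
          exact add_le_add ((abs_sub_le _ (v : ℝ) _).trans (add_le_add_left hv _))
            (intCast_div_le_ediv_add_one N (by exact_mod_cast hq))
      _ = (powStep p q n a v e).error := by
          simp only [powStep, U, N]
          push_cast
          ring

/-- The model of `S * (k + 1 + (1 + z) / 2) ^ (-p / q)`. Its value at `z = 1` serves as the initial
value of the next one, which avoids any evaluation of powers. -/
def powModel (S : ℤ) (p q n : ℕ) : ℕ → TaylorModel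
  | 0 => powStep p q n 1 S 0
  | k + 1 =>
    let M := powModel S p q n k
    powStep p q n (k + 2) (evalList M.coeffs 1) M.error

theorem powModel_encloses (S : ℤ) (p : ℕ) {q : ℕ} (n : ℕ) (hq : 0 < q) (k : ℕ) :
    (powModel S p q n k).Encloses fun z => S * (k + 1 + (1 + z) / 2) ^ (-(p / q : ℝ)) := by
  induction k with
  | zero =>
    have hstart : |(S : ℝ) * ((1 : ℤ) : ℝ) ^ (-(p / q : ℝ)) - S| ≤ (0 : ℤ) := by simp
    simpa [powModel] using powStep_encloses (n := n) hq le_rfl hstart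
  | succ k ih =>
    have hstart := ih 1 abs_one.le
    have hnode : (k + 1 + (1 + 1) / 2 : ℝ) = ((k + 2 : ℤ) : ℝ) := by push_cast; ring
    have hvalue : evalList (powModel S p q n k).coeffs (1 : ℝ) =
        (evalList (powModel S p q n k).coeffs 1 : ℤ) := by
      simpa using evalList_intCast (R := ℝ) (powModel S p q n k).coeffs 1
    beta_reduce at hstart
    rw [hnode, hvalue] at hstart
    have hstep := powStep_encloses (n := n) hq (by omega) hstart
    have hk : ((k + 2 : ℤ) : ℝ) = (k + 1 : ℕ) + 1 := by push_cast; ring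
    rwa [hk] at hstep

end TaylorModel

end Powers

section Transfer

open TaylorModel

/-- The model of the image under the Gauss transfer operator with exponent `p / q` and digits
`1, …, m` of the polynomial with coefficients `F` in the variable `z = 2 * x - 1`. -/
def transferModel (S : ℤ) (p q : ℕ) (F : List ℤ) : ℕ → TaylorModel
  | 0 => ofList []
  | m + 1 => (transferModel S p q F m).add
      (hornerMobius S (2 * m + 3) (powModel S p q F.length m) F)

theorem transferModel_encloses {S : ℤ} (p : ℕ) {q : ℕ} {F : List ℤ} (hS : 0 < S) (hq : 0 < q)
    (hF : ∀ f ∈ F, |f| ≤ S) (m : ℕ) :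
    (transferModel S p q F m).Encloses fun z =>
      gaussTransfer m (p / q) (fun x => evalList F (2 * x - 1)) ((1 + z) / 2) := by
  induction m with
  | zero => exact fun z _ => by simp [transferModel, gaussTransfer, ofList]
  | succ m ih =>
    have hdigit := (powModel_encloses S p F.length hq m).hornerMobius hS
      (by omega : (3 : ℤ) ≤ 2 * m + 3) hF
    intro z hz
    have hpos : 0 < 2 * m + 3 + z := by linarith [(abs_le.1 hz).1, m.cast_nonneg (α := ℝ)]
    have hmobius : 2 * (1 / ((m + 1 : ℕ) + (1 + z) / 2)) - 1 =
        4 / ((2 * m + 3 : ℤ) + z) - 1 := by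
      rw [show ((m + 1 : ℕ) + (1 + z) / 2 : ℝ) = (2 * m + 3 + z) / 2 by push_cast; ring]
      push_cast
      field_simp
      ring
    have hsum := (ih.add hdigit) z hz
    simp only [gaussTransfer] at hsum ⊢
    rw [Finset.sum_Icc_succ_top (by omega), hmobius]
    push_cast at hsum ⊢
    exact hsum

theorem abs_two_mul_sub_one_le {x : ℝ} (hx : x ∈ Set.Icc (0 : ℝ) 1) : |2 * x - 1| ≤ 1 :=
  abs_le.2 ⟨by linarith [hx.1], by linarith [hx.2]⟩

theorem two_mul_toNNReal_div (p q : ℕ) :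
    2 * ((p / (2 * q) : ℝ).toNNReal : ℝ) = p / q := by
  rw [Real.coe_toNNReal _ (by positivity)]
  field_simp

variable {m p q : ℕ} {S : ℤ} {F : List ℤ}

theorem dimH_contFractSet_le_of_lower (hS : 0 < S) (hq : 0 < q) (hF : ∀ f ∈ F, |f| ≤ S)
    (hpos : 0 < (ofList F).lower)
    (hle : 0 ≤ ((ofList F).sub (transferModel S p q F m)).lower) :
    dimH (contFractSet m) ≤ ENNReal.ofReal (p / (2 * q)) := by
  refine dimH_contFractSet_le (f := fun x => evalList F (2 * x - 1)) (Int.cast_pos.2 hpos)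
    (fun x hx => (ofList_encloses F).lower_le (abs_two_mul_sub_one_le hx)) fun x hx => ?_
  have hbound := ((ofList_encloses F).sub (transferModel_encloses p hS hq hF m)).lower_le
    (abs_two_mul_sub_one_le hx)
  rw [add_sub_cancel, mul_div_cancel_left₀ x two_ne_zero] at hbound
  rw [two_mul_toNNReal_div]
  exact sub_nonneg.1 ((Int.cast_nonneg hle).trans hbound)

theorem le_dimH_contFractSet_of_lower (hS : 0 < S) (hq : 0 < q) (hF : ∀ f ∈ F, |f| ≤ S)
    (hpos : 0 < (ofList F).lower)
    (hle : 0 ≤ ((transferModel S p q F m).sub (ofList F)).lower) :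
    ENNReal.ofReal (p / (2 * q)) ≤ dimH (contFractSet m) := by
  refine le_dimH_contFractSet (f := fun x => evalList F (2 * x - 1)) (C := normList F)
    (fun x hx => (Int.cast_pos.2 hpos).trans_le
      ((ofList_encloses F).lower_le (abs_two_mul_sub_one_le hx)))
    (fun x hx => (le_abs_self _).trans (abs_evalList_le F (abs_two_mul_sub_one_le hx)))
    fun x hx => ?_
  have hbound := ((transferModel_encloses p hS hq hF m).sub (ofList_encloses F)).lower_le
    (abs_two_mul_sub_one_le hx)
  rw [add_sub_cancel, mul_div_cancel_left₀ x two_ne_zero] at hbound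
  rw [two_mul_toNNReal_div]
  exact sub_nonneg.1 ((Int.cast_nonneg hle).trans hbound)

end Transfer

/-- Taylor coefficients, in `2 x - 1`, of an approximate positive eigenfunction, for the
eigenvalue `1`, of the Gauss transfer operator with digits `1, …, 5`, multiplied by `10 ^ 20`. -/
def eigenCoeffs : List ℤ := [
  100000000000000000000, -31708988764996228994, 9072259900150956911, -2587919473433696445,
  744827593244635372, -216006190027590040, 62968620836472923, -18419606941131116,
  5401088905943162, -1586578427249459, 466726637701819, -137462713357097, 40528549353090,
  -11960277276295, 3532529408498, -1044145814373, 308843173416, -91409258619, 27070369381,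
  -8021005748, 2377798732, -705205825, 209235765, -62104274, 18439975, -5476985, 1627253,
  -483607, 143762, -42748, 12713, -3783, 1125, -335, 99, -30, 8, -3]

theorem eigenCoeffs_bounds :
    (∀ f ∈ eigenCoeffs, |f| ≤ 10 ^ 20) ∧ 0 < (TaylorModel.ofList eigenCoeffs).lower := by
  decide +kernel

theorem transferModel_eigenCoeffs_le :
    0 ≤ ((TaylorModel.ofList eigenCoeffs).sub
      (transferModel (10 ^ 20) 1673658887364 (10 ^ 12) eigenCoeffs 5)).lower := by
  decide +kernel

theorem eigenCoeffs_le_transferModel :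
    0 ≤ ((transferModel (10 ^ 20) 1673658887360 (10 ^ 12) eigenCoeffs 5).sub
      (TaylorModel.ofList eigenCoeffs)).lower := by
  decide +kernel

theorem mainTheorem6 :
    dimH (contFractSet 5) ∈
      Set.Icc (ENNReal.ofReal (0.836829443681 - 10 ^ (-12 : ℤ)))
        (ENNReal.ofReal (0.836829443681 + 10 ^ (-12 : ℤ))) ∧
    (5 / 6 : ℝ≥0∞) < dimH (contFractSet 5) := by
  obtain ⟨hF, hpos⟩ := eigenCoeffs_bounds
  have hlower := le_dimH_contFractSet_of_lower (by norm_num) (by norm_num) hF hpos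
    eigenCoeffs_le_transferModel
  have hupper := dimH_contFractSet_le_of_lower (by norm_num) (by norm_num) hF hpos
    transferModel_eigenCoeffs_le
  have hlower_eq : (1673658887360 : ℕ) / (2 * (10 ^ 12 : ℕ)) =
      (0.836829443681 - 10 ^ (-12 : ℤ) : ℝ) := by norm_num
  have hupper_eq : (1673658887364 : ℕ) / (2 * (10 ^ 12 : ℕ)) =
      (0.836829443681 + 10 ^ (-12 : ℤ) : ℝ) := by norm_num
  have hfive_sixths : (5 / 6 : ℝ≥0∞) = ENNReal.ofReal (5 / 6) := by
    rw [ENNReal.ofReal_div_of_pos (by norm_num)]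
    norm_num
  rw [hlower_eq] at hlower
  rw [hupper_eq] at hupper
  refine ⟨⟨hlower, hupper⟩, lt_of_lt_of_le ?_ hlower⟩
  rw [hfive_sixths]
  exact (ENNReal.ofReal_lt_ofReal_iff (by norm_num)).2 (by norm_num)
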